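/- **Model.** A finite set of tasks $\tau_i$ shares a finite set of resources $\ell_q$. Task $\tau_i$ has a finite acyclic graph with a unique source (head) and a unique sink (tail), vertex worst-case execution times $c(v)\ge 0$ (which include lock-holding time but not spinning time), a period $T_i$ and a relative deadline $D_i$ with $0<D_i\le T_i$. Let $\mathcal C_i=\sum_v c(v)$ and let $\mathcal L_i$ be the largest total $c$ along a path from head to tail. Consecutive releases of jobs of $\tau_i$ are at least $T_i$ apart. Each vertex of a job executes for at most $c(v)$ time units. $\Theta_i$ is the set of resources accessed by $\tau_i$; a job of $\tau_i$ accesses $\ell_q$ at most $N_{i,q}$ times, each access having positive length at most $L_{i,q}$ and lying within one vertex; accesses are not nested. Task $\tau_i$ runs exclusively on $m_i\ge 1$ dedicated processors under a work-conserving scheduler: whenever an unfinished vertex of a released job whose predecessors are all finished is neither executing nor spinning, all $m_i$ processors are busy. Each resource is protected by a spin lock, held by at most one vertex in the whole system at any time; a vertex that requests a lock held by another vertex (of the same or of another task) spins until it obtains it; a vertex is not preempted while it spins or holds a lock; waiting requests are served in an arbitrary order (unordered). The response time of a job is its finish time minus its release time, and the worst-case response time $R_i$ of $\tau_i$ is the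 supremum of the response times of its released jobs. **Theorem.** Put $$\eta_{i,j}^q=\begin{cases}\left\lceil \dfrac{D_i+D_j}{T_j}\right\rceil & \text{if } \ell_q\in\Theta_i\cap\Theta_j,\\[1ex] 0 & \text{otherwise,}\end{cases}$$ $$\mathcal B_i=\frac{\mathcal C_i+(m_i-1)\Bigl(\mathcal L_i+\sum_{\ell_q\in\Theta_i}N_{i,q}L_{i,q}\Bigr)}{m_i}+\sum_{j\ne i}\ \sum_{\ell_q\in\Theta_i}\eta_{i,j}^q\,N_{j,q}\,L_{j,q}.$$ Suppose that every task $\tau_k$ is schedulable ($R_k\le D_k$) or satisfies $\mathcal B_k\le D_k$. Then $R_i\le \mathcal B_i$ for every task $\tau_i$. -/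

import Mathlib

open MeasureTheory

noncomputable section

namespace SpinLock

/-- A system of DAG tasks (indexed by `ι`) sharing resources (indexed by `ρ`) under federated
scheduling; `V i` is the vertex set of task `i`. -/
structure TaskSystem (ι ρ : Type*) (V : ι → Type*) where
  /-- `edge i u v`: `u` is a predecessor of `v` in the graph of task `i` -/
  edge : ∀ i, V i → V i → Prop
  acyclic : ∀ i v, ¬ Relation.TransGen (edge i) v v
  head : ∀ i, V i
  tail : ∀ i, V i
  /-- the head is the only vertex without predecessors -/
  head_iff : ∀ i v, (∀ u, ¬ edge i u v) ↔ v = head i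
  /-- the tail is the only vertex without successors -/
  tail_iff : ∀ i v, (∀ w, ¬ edge i v w) ↔ v = tail i
  /-- worst-case execution time of a vertex: includes lock holding, excludes spinning -/
  wcet : ∀ i, V i → ℝ
  wcet_nonneg : ∀ i v, 0 ≤ wcet i v
  /-- `T i` -/
  period : ι → ℝ
  /-- relative deadline `D i` -/
  deadline : ι → ℝ
  deadline_pos : ∀ i, 0 < deadline i
  deadline_le_period : ∀ i, deadline i ≤ period i
  /-- the number `m i` of processors dedicated to task `i` -/
  procs : ι → ℕ
  procs_pos : ∀ i, 0 < procs i
  /-- `Θ i`, the resources that task `i` accesses -/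
  resources : ι → Finset ρ
  /-- `N i q`, the worst-case number of accesses to `q` by a job of task `i` -/
  numAccess : ι → ρ → ℕ
  /-- `L i q`, the worst-case duration of a single access to `q` by task `i` -/
  accessTime : ι → ρ → ℝ
  accessTime_nonneg : ∀ i q, 0 ≤ accessTime i q

/-- One access to resource `res` by a vertex: the vertex must hold the lock of `res` exactly
while the amount of execution it has received lies in `[start, start + len)`. -/
structure CritSection (ρ : Type*) where
  res : ρ
  start : ℝ
  len : ℝ

/-- What a processor is doing: idle, executing vertex `v` of the `k`-th job (with or without
a lock), or spinning on behalf of that vertex. -/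
inductive ProcState (V : Type*) where
  | idle : ProcState V
  | executing (k : ℕ) (v : V) : ProcState V
  | spinning (k : ℕ) (v : V) : ProcState V

variable {ι ρ : Type*} {V : ι → Type*}

namespace TaskSystem

/-- Total worst-case execution time of task `i`. -/
def totalWork [∀ i, Fintype (V i)] (S : TaskSystem ι ρ V) (i : ι) : ℝ :=
  ∑ v, S.wcet i v

/-- Complete paths of the graph of task `i`, from the head to the tail. -/
def IsCompletePath (S : TaskSystem ι ρ V) (i : ι) (l : List (V i)) : Prop :=
  l.IsChain (S.edge i) ∧ l.head? = some (S.head i) ∧ l.getLast? = some (S.tail i)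

/-- The length of the longest complete path of task `i`. -/
def longestPath (S : TaskSystem ι ρ V) (i : ι) : ℝ :=
  sSup {x | ∃ l, S.IsCompletePath i l ∧ x = (l.map (S.wcet i)).sum}

/-- The bound on the number of jobs of task `j` contending for `q` with a job of task `i`. -/
def eta [DecidableEq ρ] (S : TaskSystem ι ρ V) (i j : ι) (q : ρ) : ℕ :=
  if q ∈ S.resources i ∧ q ∈ S.resources j then
    ⌈(S.deadline i + S.deadline j) / S.period j⌉₊
  else 0

/-- The response time bound of task `i` for unordered spin locks. -/
def unorderedBound [Fintype ι] [DecidableEq ι] [DecidableEq ρ] [∀ i, Fintype (V i)]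
    (S : TaskSystem ι ρ V) (i : ι) : ℝ :=
  (S.totalWork i + ((S.procs i : ℝ) - 1) *
      (S.longestPath i + ∑ q ∈ S.resources i, (S.numAccess i q : ℝ) * S.accessTime i q))
    / (S.procs i : ℝ)
  + ∑ j ∈ Finset.univ.erase i, ∑ q ∈ S.resources i,
      (S.eta i j q : ℝ) * (S.numAccess j q : ℝ) * S.accessTime j q

end TaskSystem

/-- The jobs released at run time, and the actual demand of each of them. The jobs of task `i`
are numbered by the set `released i`, in order of release. -/
structure Workload [DecidableEq ρ] [∀ i, Fintype (V i)] (S : TaskSystem ι ρ V) where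
  released : ι → Set ℕ
  release : ι → ℕ → ℝ
  separation : ∀ i, ∀ k ∈ released i, ∀ l ∈ released i, k < l →
    release i k + S.period i ≤ release i l
  /-- actual execution time of a vertex of a job -/
  execTime : ∀ i, ℕ → V i → ℝ
  execTime_nonneg : ∀ i k v, 0 ≤ execTime i k v
  execTime_le : ∀ i k v, execTime i k v ≤ S.wcet i v
  /-- the accesses made by a vertex of a job -/
  sections : ∀ i, ℕ → V i → List (CritSection ρ)
  sections_res : ∀ i k v, ∀ s ∈ sections i k v, s.res ∈ S.resources i
  sections_start : ∀ i k v, ∀ s ∈ sections i k v, 0 ≤ s.start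
  sections_len_pos : ∀ i k v, ∀ s ∈ sections i k v, 0 < s.len
  sections_len_le : ∀ i k v, ∀ s ∈ sections i k v, s.len ≤ S.accessTime i s.res
  /-- an access does not extend beyond its vertex -/
  sections_end : ∀ i k v, ∀ s ∈ sections i k v, s.start + s.len ≤ execTime i k v
  /-- accesses of a vertex are listed in order and are not nested -/
  sections_disjoint : ∀ i k v,
    (sections i k v).Pairwise fun s s' => s.start + s.len ≤ s'.start
  sections_count : ∀ i k q,
    ∑ v, (sections i k v).countP (fun s => decide (s.res = q)) ≤ S.numAccess i q

namespace Workload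

variable [DecidableEq ρ] [∀ i, Fintype (V i)] {S : TaskSystem ι ρ V}

/-- An assignment of a state to each processor at each time; `Fin (S.procs i)` are the
processors dedicated to task `i`, which only serve vertices of task `i`. -/
abbrev Trace (_W : Workload S) : Type _ :=
  ∀ i, Fin (S.procs i) → ℝ → ProcState (V i)

variable (W : Workload S) (σ : W.Trace)

/-- Vertex `v` of job `k` of task `i` is executing at time `t`. -/
def Executing (i : ι) (k : ℕ) (v : V i) (t : ℝ) : Prop :=
  ∃ p, σ i p t = .executing k v

/-- Processor `p` is busy with vertex `v` of job `k` of task `i` at time `t`. -/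
def BusyWith (i : ι) (p : Fin (S.procs i)) (k : ℕ) (v : V i) (t : ℝ) : Prop :=
  σ i p t = .executing k v ∨ σ i p t = .spinning k v

/-- The amount of execution that a vertex has received before time `t`. -/
def progress (i : ι) (k : ℕ) (v : V i) (t : ℝ) : ℝ :=
  volume.real ({s | W.Executing σ i k v s} ∩ Set.Ico (W.release i k) t)

/-- Vertex `v` of job `k` is finished at time `t`: it and all its ancestors have received
their execution time. -/
def VertexFinished (i : ι) (k : ℕ) (v : V i) (t : ℝ) : Prop :=
  W.release i k ≤ t ∧
    ∀ u, Relation.ReflTransGen (S.edge i) u v → W.execTime i k u ≤ W.progress σ i k u t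

/-- Vertex `v` of job `k` is eligible (and unfinished) at time `t`. -/
def Eligible (i : ι) (k : ℕ) (v : V i) (t : ℝ) : Prop :=
  k ∈ W.released i ∧ W.release i k ≤ t ∧
    (∀ u, S.edge i u v → W.VertexFinished σ i k u t) ∧ ¬ W.VertexFinished σ i k v t

/-- Vertex `v` of job `k` of task `i` holds the lock of `q` at time `t`. -/
def Holds (i : ι) (k : ℕ) (v : V i) (q : ρ) (t : ℝ) : Prop :=
  W.Executing σ i k v t ∧ ∃ s ∈ W.sections i k v, s.res = q ∧
    s.start ≤ W.progress σ i k v t ∧ W.progress σ i k v t < s.start + s.len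

/-- The traces produced by work-conserving federated scheduling with non-preemptive spin locks,
requests being served in an arbitrary order. -/
structure IsSchedule : Prop where
  measurable : ∀ i p x, MeasurableSet {t | σ i p t = x}
  /-- a vertex occupies at most one processor at a time -/
  one_proc : ∀ i p p' k v t, W.BusyWith σ i p k v t → W.BusyWith σ i p' k v t → p = p'
  /-- only eligible vertices execute or spin -/
  eligible : ∀ i p k v t, W.BusyWith σ i p k v t → W.Eligible σ i k v t
  /-- a lock is held by at most one vertex in the whole system -/
  mutex : ∀ i k v j l u q t, W.Holds σ i k v q t → W.Holds σ j l u q t →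
    (⟨i, k, v⟩ : Σ i, ℕ × V i) = ⟨j, l, u⟩
  /-- a vertex spins only when it is about to start an access to a resource whose lock is held
  (necessarily by another vertex, of the same or of another task) -/
  spinning : ∀ i p k v t, σ i p t = .spinning k v →
    ∃ s ∈ W.sections i k v, W.progress σ i k v t = s.start ∧
      ∃ j l u, W.Holds σ j l u s.res t
  /-- spinning is non-preemptive, until the lock is obtained -/
  spin_nonpreemptive : ∀ i p k v t t', t ≤ t' → σ i p t = .spinning k v →
    W.progress σ i k v t' = W.progress σ i k v t → W.BusyWith σ i p k v t'
  /-- execution is non-preemptive while a lock is held -/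
  hold_nonpreemptive : ∀ i p k v t t', t ≤ t' → σ i p t = .executing k v →
    ∀ s ∈ W.sections i k v, s.start ≤ W.progress σ i k v t →
      W.progress σ i k v t' < s.start + s.len → σ i p t' = .executing k v
  /-- an eligible vertex only waits when all processors of its task are busy -/
  work_conserving : ∀ i k v t, W.Eligible σ i k v t →
    (∃ p, W.BusyWith σ i p k v t) ∨ ∀ p, σ i p t ≠ .idle

/-- Job `k` of task `i` is finished at time `t`. -/
def JobFinished (i : ι) (k : ℕ) (t : ℝ) : Prop :=
  ∀ v, W.VertexFinished σ i k v t

/-- Finish time of a job (`⊤` if it never finishes). -/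
def finishTime (i : ι) (k : ℕ) : EReal :=
  sInf {x | ∃ t : ℝ, W.JobFinished σ i k t ∧ x = (t : EReal)}

/-- Response time of a job. -/
def responseTime (i : ι) (k : ℕ) : EReal :=
  W.finishTime σ i k - (W.release i k : EReal)

/-- Worst-case response time of task `i`, over all its released jobs. -/
def wcrt (i : ι) : EReal :=
  ⨆ k ∈ W.released i, W.responseTime σ i k

end Workload

end SpinLock

end


/-!
Suppose that `𝓑 i ≤ D i` and that a job of task `i`, released at `r`, is unfinished `𝓑 i` later.
Tracing back from the tail the predecessor that finishes last yields a complete path that has an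
eligible vertex at every time. While no other task holds a lock of `Θ i`, the path executes, or the
job itself holds a lock, or nothing spins and, by work conservation, all `m i` processors execute
the job; in the first two cases at least one of them still does. If the other tasks hold such locks
for a time `X`, counting processor time therefore gives
`m i * (𝓑 i - X) < 𝓒 i + (m i - 1) * (𝓛 i + ∑ q, N i q * L i q)`, strictly because the job is
unfinished.

The locks held in the window by task `j` belong to jobs released in `[r - D j, r + D i)`, the
earlier ones having met their deadlines, and there are at most `⌈(D i + D j) / T j⌉` of those. So
`X` is at most the blocking term of `𝓑 i`, a contradiction. That the earlier jobs of all tasks meet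
their deadlines follows by induction on the release times, which form a well-ordered set.
-/

namespace SpinLock

open scoped ENNReal

section Measure

/-- On `Z` the number of sets `P p` that contain a point, plus `Fintype.card κ - 1` on `G`, is at
least `Fintype.card κ`; integrate this. -/
theorem card_mul_measure_le_sum_add {α κ : Type*} [MeasurableSpace α] [Fintype κ]
    (μ : Measure α) {P : κ → Set α} (hP : ∀ p, MeasurableSet (P p)) {G Z : Set α}
    (hsome : Z ∩ G ⊆ ⋃ p, P p) (hall : ∀ p, Z \ G ⊆ P p) :
    Fintype.card κ * μ Z ≤ ∑ p, μ (P p) + (Fintype.card κ - 1 : ℕ) * μ G := by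
  set G' := toMeasurable μ G
  have hG' : MeasurableSet G' := measurableSet_toMeasurable μ G
  set f : α → ℝ≥0∞ := fun t =>
    ∑ p, (P p).indicator 1 t + (Fintype.card κ - 1 : ℕ) * G'.indicator 1 t
  have hcover : Z ⊆ {t | (Fintype.card κ : ℝ≥0∞) ≤ f t} := by
    intro t ht
    rw [Set.mem_ofPred_eq]
    by_cases hG : t ∈ G
    · obtain ⟨p, hp⟩ := Set.mem_iUnion.1 (hsome ⟨ht, hG⟩)
      have hone : 1 ≤ ∑ p, (P p).indicator (1 : α → ℝ≥0∞) t := by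
        refine le_of_eq_of_le ?_ (Finset.single_le_sum (fun _ _ => zero_le) (Finset.mem_univ p))
        simp [hp]
      have hcard : 1 + (Fintype.card κ - 1) = Fintype.card κ :=
        Nat.add_sub_cancel' (Fintype.card_pos_iff.2 ⟨p⟩)
      calc (Fintype.card κ : ℝ≥0∞) = 1 + (Fintype.card κ - 1 : ℕ) := by
            rw [← hcard]; push_cast; simp
        _ ≤ f t := add_le_add hone (by simp [G', subset_toMeasurable μ G hG])
    · have hmem : ∀ p, t ∈ P p := fun p => hall p ⟨ht, hG⟩
      simp [f, hmem]
  have hf : Measurable f := by fun_prop (disch := measurability)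
  calc (Fintype.card κ : ℝ≥0∞) * μ Z
      ≤ Fintype.card κ * μ {t | (Fintype.card κ : ℝ≥0∞) ≤ f t} := by gcongr
    _ ≤ ∫⁻ t, f t ∂μ := mul_meas_ge_le_lintegral hf _
    _ = ∑ p, μ (P p) + (Fintype.card κ - 1 : ℕ) * μ G := by
      rw [lintegral_add_right _ (by fun_prop (disch := measurability)),
        lintegral_finsetSum _ (by fun_prop (disch := measurability)),
        lintegral_const_mul _ (by fun_prop (disch := measurability))]
      simp only [lintegral_indicator_one, hP, hG', G', measure_toMeasurable]

/-- The amount of time spent in `E` between `r` and `t`. It turns the amount of execution that a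
vertex has received into a continuous function of time. -/
noncomputable def elapsed (E : Set ℝ) (r t : ℝ) : ℝ := volume.real (E ∩ Set.Ico r t)

theorem measure_inter_Ico_ne_top (E : Set ℝ) (r t : ℝ) : volume (E ∩ Set.Ico r t) ≠ ∞ :=
  measure_ne_top_of_subset Set.inter_subset_right measure_Ico_lt_top.ne

theorem ofReal_elapsed (E : Set ℝ) (r t : ℝ) :
    ENNReal.ofReal (elapsed E r t) = volume (E ∩ Set.Ico r t) :=
  ofReal_measureReal (measure_inter_Ico_ne_top E r t)

theorem elapsed_nonneg (E : Set ℝ) (r t : ℝ) : 0 ≤ elapsed E r t := measureReal_nonneg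

theorem elapsed_mono (E : Set ℝ) (r : ℝ) : Monotone (elapsed E r) := fun _ t h =>
  measureReal_mono (Set.inter_subset_inter_right _ (Set.Ico_subset_Ico_right h))
    (measure_inter_Ico_ne_top E r t)

theorem elapsed_le_elapsed_add_elapsed (E : Set ℝ) (r s t : ℝ) :
    elapsed E r t ≤ elapsed E r s + elapsed E s t := by
  refine (measureReal_mono ?_ ?_).trans (measureReal_union_le _ _)
  · rw [← Set.inter_union_distrib_left]
    exact Set.inter_subset_inter_right _ Set.Ico_subset_Ico_union_Ico
  · exact measure_union_ne_top (measure_inter_Ico_ne_top E r s) (measure_inter_Ico_ne_top E s t)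

theorem elapsed_add_elapsed (E : Set ℝ) {r s t : ℝ} (hrs : r ≤ s) (hst : s ≤ t) :
    elapsed E r s + elapsed E s t = elapsed E r t := by
  have hsplit := measureReal_inter_add_sdiff (μ := volume) (s := E ∩ Set.Ico r t)
    (measurableSet_Iio (a := s)) (measure_inter_Ico_ne_top E r t)
  rw [elapsed, elapsed, elapsed, ← hsplit]
  congr 2 <;> grind

theorem elapsed_le_sub (E : Set ℝ) {s t : ℝ} (h : s ≤ t) : elapsed E s t ≤ t - s := by
  rw [← Real.volume_real_Ico_of_le h]
  exact measureReal_mono Set.inter_subset_right measure_Ico_lt_top.ne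

theorem continuous_elapsed (E : Set ℝ) (r : ℝ) : Continuous (elapsed E r) := by
  refine (LipschitzWith.of_le_add fun t s => ?_).continuous
  rcases le_total t s with h | h
  · exact (elapsed_mono E r h).trans (le_add_of_nonneg_right dist_nonneg)
  · rw [Real.dist_eq, abs_of_nonneg (sub_nonneg.2 h)]
    exact (elapsed_le_elapsed_add_elapsed E r s t).trans (by grw [elapsed_le_sub E h])

/-- By inner regularity the set may be taken compact, in which case it lies between two of its
points, and the time spent in `E` between those is the increment of `elapsed E r`. -/
theorem measure_inter_elapsed_preimage_Ico_le {E : Set ℝ} (hE : MeasurableSet E) {r : ℝ}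
    (hr : E ⊆ Set.Ici r) (a b : ℝ) :
    volume (E ∩ elapsed E r ⁻¹' Set.Ico a b) ≤ ENNReal.ofReal (b - a) := by
  have hmeas : MeasurableSet (E ∩ elapsed E r ⁻¹' Set.Ico a b) :=
    hE.inter ((continuous_elapsed E r).measurable measurableSet_Ico)
  rw [hmeas.measure_eq_iSup_isCompact]
  refine iSup₂_le fun K hKE => iSup_le fun hK => ?_
  rcases K.eq_empty_or_nonempty with rfl | hne
  · simp
  obtain ⟨s, hsK, hs⟩ := hK.exists_isLeast hne
  obtain ⟨t, htK, ht⟩ := hK.exists_isGreatest hne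
  calc volume K ≤ volume (E ∩ Set.Icc s t) :=
        measure_mono fun x hx => ⟨(hKE hx).1, hs hx, ht hx⟩
    _ = volume (E ∩ Set.Ico s t) :=
        measure_congr ((ae_eq_refl E).inter Ico_ae_eq_Icc.symm)
    _ = ENNReal.ofReal (elapsed E s t) := (ofReal_elapsed E s t).symm
    _ ≤ ENNReal.ofReal (b - a) := by
        refine ENNReal.ofReal_le_ofReal ?_
        have hadd := elapsed_add_elapsed E (hr (hKE hsK).1) (hs htK)
        linarith [(hKE hsK).2.1, (hKE htK).2.2]

end Measure

theorem encard_inter_preimage_Ico_le {α K : Type*} [Field K] [LinearOrder K]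
    [IsStrictOrderedRing K] [FloorRing K] {A : Set α} {f : α → K} {T : K} (hT : 0 < T)
    (hsep : A.Pairwise fun k l => T ≤ |f k - f l|) (a b : K) :
    (A ∩ f ⁻¹' Set.Ico a b).encard ≤ ⌈(b - a) / T⌉₊ := by
  have hmaps : Set.MapsTo (fun k => ⌊(f k - a) / T⌋) (A ∩ f ⁻¹' Set.Ico a b)
      (Finset.Ico 0 (⌈(b - a) / T⌉₊ : ℤ)) := by
    rintro k ⟨-, hak, hkb⟩
    have hlt : (f k - a) / T < (b - a) / T := by gcongr
    rw [Finset.mem_coe, Finset.mem_Ico, Int.floor_nonneg, Int.floor_lt]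
    exact ⟨div_nonneg (sub_nonneg.2 hak) hT.le, by exact_mod_cast hlt.trans_le (Nat.le_ceil _)⟩
  have hinj : Set.InjOn (fun k => ⌊(f k - a) / T⌋) (A ∩ f ⁻¹' Set.Ico a b) := by
    intro k hk l hl hkl
    by_contra hne
    have hlt := Int.abs_sub_lt_one_of_floor_eq_floor hkl
    rw [← sub_div, sub_sub_sub_cancel_right, abs_div, abs_of_pos hT, div_lt_one hT] at hlt
    exact hlt.not_ge (hsep hk.1 hl.1 hne)
  refine (Set.encard_le_encard_of_injOn hmaps hinj).trans_eq ?_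
  rw [Set.encard_coe_eq_coe_finsetCard, Int.card_Ico, sub_zero, Int.toNat_natCast]

section Acyclic

variable {α : Type*} {r : α → α → Prop}

theorem wellFounded_of_acyclic [Finite α] (h : ∀ a, ¬ Relation.TransGen r a a) :
    WellFounded r := by
  have : Std.Irrefl (Relation.TransGen r) := ⟨h⟩
  exact Subrelation.wf Relation.TransGen.single
    (Finite.wellFounded_of_trans_of_irrefl (Relation.TransGen r))

theorem nodup_of_isChain_of_acyclic (h : ∀ a, ¬ Relation.TransGen r a a) {l : List α}
    (hl : l.IsChain r) : l.Nodup := by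
  refine (List.isChain_iff_pairwise.1 (hl.imp fun _ _ => Relation.TransGen.single)).imp ?_
  rintro a _ hab rfl
  exact h a hab

end Acyclic

namespace TaskSystem

variable {ι ρ : Type*} {V : ι → Type*} (S : TaskSystem ι ρ V) (i : ι)

/-- A bound on the time for which a job of task `i` holds locks. -/
noncomputable def ownAccessTime : ℝ :=
  ∑ q ∈ S.resources i, (S.numAccess i q : ℝ) * S.accessTime i q

/-- A bound on the time for which the other tasks hold locks of resources of task `i` during the
execution of one of its jobs. -/
noncomputable def interTaskBlocking [Fintype ι] [DecidableEq ι] [DecidableEq ρ] : ℝ :=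
  ∑ j ∈ Finset.univ.erase i, ∑ q ∈ S.resources i,
    (S.eta i j q : ℝ) * (S.numAccess j q : ℝ) * S.accessTime j q

theorem unorderedBound_eq [Fintype ι] [DecidableEq ι] [DecidableEq ρ] [∀ i, Fintype (V i)] :
    S.unorderedBound i =
      (S.totalWork i + ((S.procs i : ℝ) - 1) * (S.longestPath i + S.ownAccessTime i)) /
        S.procs i + S.interTaskBlocking i :=
  rfl

theorem one_le_cast_procs : (1 : ℝ) ≤ S.procs i := by
  exact_mod_cast S.procs_pos i

theorem procs_mul_unorderedBound [Fintype ι] [DecidableEq ι] [DecidableEq ρ]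
    [∀ i, Fintype (V i)] :
    S.procs i * S.unorderedBound i =
      S.totalWork i + ((S.procs i : ℝ) - 1) * (S.longestPath i + S.ownAccessTime i) +
        S.procs i * S.interTaskBlocking i := by
  have hprocs : (S.procs i : ℝ) ≠ 0 := Nat.cast_ne_zero.2 (S.procs_pos i).ne'
  rw [unorderedBound_eq, mul_add, mul_div_cancel₀ _ hprocs]

theorem period_pos : 0 < S.period i :=
  (S.deadline_pos i).trans_le (S.deadline_le_period i)

variable {i} in
theorem eta_of_mem [DecidableEq ρ] {j : ι} {q : ρ} (hi : q ∈ S.resources i)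
    (hj : q ∈ S.resources j) :
    S.eta i j q = ⌈(S.deadline i + S.deadline j) / S.period j⌉₊ :=
  if_pos ⟨hi, hj⟩

theorem numAccess_mul_accessTime_nonneg (q : ρ) :
    0 ≤ (S.numAccess i q : ℝ) * S.accessTime i q :=
  mul_nonneg (Nat.cast_nonneg _) (S.accessTime_nonneg i q)

theorem eta_mul_numAccess_mul_accessTime_nonneg [DecidableEq ρ] (j : ι) (q : ρ) :
    0 ≤ (S.eta i j q : ℝ) * (S.numAccess j q : ℝ) * S.accessTime j q :=
  mul_nonneg (by positivity) (S.accessTime_nonneg j q)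

theorem ownAccessTime_nonneg : 0 ≤ S.ownAccessTime i :=
  Finset.sum_nonneg fun q _ => S.numAccess_mul_accessTime_nonneg i q

theorem interTaskBlocking_nonneg [Fintype ι] [DecidableEq ι] [DecidableEq ρ] :
    0 ≤ S.interTaskBlocking i :=
  Finset.sum_nonneg fun j _ => Finset.sum_nonneg fun q _ =>
    S.eta_mul_numAccess_mul_accessTime_nonneg i j q

theorem longestPath_nonneg : 0 ≤ S.longestPath i := by
  refine Real.sSup_nonneg ?_
  rintro _ ⟨l, -, rfl⟩
  refine List.sum_nonneg (List.forall_mem_map.2 fun v _ => S.wcet_nonneg i v)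

theorem reflTransGen_tail [Finite (V i)] (v : V i) :
    Relation.ReflTransGen (S.edge i) v (S.tail i) := by
  have hwf : WellFounded (Function.swap (S.edge i)) :=
    wellFounded_of_acyclic fun v h => S.acyclic i v (Relation.transGen_swap.1 h)
  induction v using hwf.induction with
  | _ v ih =>
    by_cases hv : v = S.tail i
    · rw [hv]
    · rw [← S.tail_iff i v] at hv
      push Not at hv
      obtain ⟨w, hvw⟩ := hv
      exact (ih w hvw).head hvw

theorem sum_wcet_le_longestPath [Finite (V i)] {l : List (V i)} (hl : S.IsCompletePath i l) :
    (l.map (S.wcet i)).sum ≤ S.longestPath i := by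
  classical
  have := Fintype.ofFinite (V i)
  have hfin : {l : List (V i) | l.Nodup}.Finite :=
    Set.finite_coe_iff.1 (inferInstanceAs (Finite {l : List (V i) // l.Nodup}))
  refine le_csSup ((hfin.image fun l => (l.map (S.wcet i)).sum).bddAbove.mono ?_) ⟨l, hl, rfl⟩
  rintro _ ⟨l', hl', rfl⟩
  exact ⟨l', nodup_of_isChain_of_acyclic (S.acyclic i) hl'.1, rfl⟩

variable [∀ i, Fintype (V i)]

theorem totalWork_nonneg : 0 ≤ S.totalWork i :=
  Finset.sum_nonneg fun v _ => S.wcet_nonneg i v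

theorem unorderedBound_nonneg [Fintype ι] [DecidableEq ι] [DecidableEq ρ] :
    0 ≤ S.unorderedBound i := by
  have hprocs := sub_nonneg.2 (S.one_le_cast_procs i)
  have hwork := S.totalWork_nonneg i
  have hpath := S.longestPath_nonneg i
  have haccess := S.ownAccessTime_nonneg i
  have hblocking := S.interTaskBlocking_nonneg i
  rw [unorderedBound_eq]
  positivity

end TaskSystem

namespace Workload

variable {ι ρ : Type*} {V : ι → Type*} [DecidableEq ρ] [∀ i, Fintype (V i)]
  {S : TaskSystem ι ρ V}

section Definitions

variable (W : Workload S) (σ : W.Trace)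

/-- Schedules in which a vertex is busy only while it is eligible, spins only for a lock that is
held, and never waits beside an idle processor. In contrast to `IsSchedule`, several vertices may
hold the same lock, and vertices may be preempted at any time. -/
structure IsWorkConservingSchedule : Prop where
  measurable : ∀ i p x, MeasurableSet {t | σ i p t = x}
  one_proc : ∀ i p p' k v t, W.BusyWith σ i p k v t → W.BusyWith σ i p' k v t → p = p'
  eligible : ∀ i p k v t, W.BusyWith σ i p k v t → W.Eligible σ i k v t
  spinning : ∀ i p k v t, σ i p t = .spinning k v →
    ∃ s ∈ W.sections i k v, W.progress σ i k v t = s.start ∧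
      ∃ j l u, W.Holds σ j l u s.res t
  work_conserving : ∀ i k v t, W.Eligible σ i k v t →
    (∃ p, W.BusyWith σ i p k v t) ∨ ∀ p, σ i p t ≠ .idle

/-- Job `l` of task `j` is finished at all times after its absolute deadline. The deadline itself
is excluded because the finish time is only an infimum. -/
def MeetsDeadline (j : ι) (l : ℕ) : Prop :=
  ∀ t, W.release j l + S.deadline j < t → W.JobFinished σ j l t

/-- The induction hypothesis on release times: the jobs of task `j` released before `r` meet their
deadlines. -/
def MeetsDeadlinesBefore (j : ι) (r : ℝ) : Prop :=
  ∀ l ∈ W.released j, W.release j l < r → W.MeetsDeadline σ j l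

/-- The times at which processor `p` executes a vertex of job `k` of task `i`. -/
def jobExecution (i : ι) (k : ℕ) (p : Fin (S.procs i)) : Set ℝ :=
  {t | ∃ v, σ i p t = .executing k v}

/-- The times at which a vertex of `l`, in applications a path, of job `k` of task `i` executes. -/
def pathExecution (i : ι) (k : ℕ) (l : List (V i)) : Set ℝ :=
  {t | ∃ v ∈ l, W.Executing σ i k v t}

/-- The times at which job `k` of task `i` holds the lock of `q`. -/
def jobHolding (i : ι) (k : ℕ) (q : ρ) : Set ℝ :=
  {t | ∃ v, W.Holds σ i k v q t}

/-- The times at which job `k` of task `i` holds a lock and may thereby block its own vertices. -/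
def ownHolding (i : ι) (k : ℕ) : Set ℝ :=
  ⋃ q ∈ S.resources i, W.jobHolding σ i k q

/-- The times at which another task holds a lock of a resource of task `i` and may thereby block
task `i`. -/
def foreignHolding (i : ι) : Set ℝ :=
  {t | ∃ j ≠ i, ∃ q ∈ S.resources i, ∃ l, t ∈ W.jobHolding σ j l q}

end Definitions

variable {W : Workload S} {σ : W.Trace} {i j : ι} {k : ℕ}

theorem IsSchedule.isWorkConservingSchedule (hσ : W.IsSchedule σ) :
    W.IsWorkConservingSchedule σ where
  measurable := hσ.measurable
  one_proc := hσ.one_proc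
  eligible := hσ.eligible
  spinning := hσ.spinning
  work_conserving := hσ.work_conserving

section Releases

variable (W)

theorem release_strictMonoOn (j : ι) : StrictMonoOn (W.release j) (W.released j) :=
  fun k hk l hl hkl =>
    (lt_add_of_pos_right _ (S.period_pos j)).trans_le (W.separation j k hk l hl hkl)

theorem pairwise_period_le_abs_release_sub (j : ι) :
    (W.released j).Pairwise fun k l => S.period j ≤ |W.release j k - W.release j l| := by
  intro k hk l hl hne
  rw [le_abs]
  rcases lt_or_gt_of_ne hne with h | h
  · exact Or.inr (by linarith [W.separation j k hk l hl h])
  · exact Or.inl (by linarith [W.separation j l hl k hk h])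

theorem isWF_iUnion_release_image_released [Finite ι] :
    (⋃ j, W.release j '' W.released j).IsWF := by
  have := Fintype.ofFinite ι
  have hpwo (j : ι) : (W.release j '' W.released j).IsPWO :=
    (Set.IsPWO.of_linearOrder _).image_of_monotoneOn (W.release_strictMonoOn j).monotoneOn
  simpa using (Finset.univ.isWF_bUnion).2 fun j _ => (hpwo j).isWF

end Releases

section Finishing

theorem VertexFinished.mono {v : V i} {s t : ℝ} (h : W.VertexFinished σ i k v s) (hst : s ≤ t) :
    W.VertexFinished σ i k v t :=
  ⟨h.1.trans hst, fun u hu => (h.2 u hu).trans (elapsed_mono _ _ hst)⟩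

theorem JobFinished.mono {s t : ℝ} (h : W.JobFinished σ i k s) (hst : s ≤ t) :
    W.JobFinished σ i k t :=
  fun v => (h v).mono hst

theorem jobFinished_of_vertexFinished_tail {t : ℝ} (h : W.VertexFinished σ i k (S.tail i) t) :
    W.JobFinished σ i k t :=
  fun v => ⟨h.1, fun u hu => h.2 u (hu.trans (S.reflTransGen_tail i v))⟩

theorem exists_progress_lt_of_not_jobFinished {t : ℝ} (ht : W.release i k ≤ t)
    (h : ¬ W.JobFinished σ i k t) : ∃ v, W.progress σ i k v t < W.execTime i k v := by
  by_contra! hall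
  exact h fun _ => ⟨ht, fun u _ => hall u⟩

theorem Eligible.progress_lt {v : V i} {t : ℝ} (h : W.Eligible σ i k v t) :
    W.progress σ i k v t < W.execTime i k v := by
  obtain ⟨-, hrelease, hpred, hunfinished⟩ := h
  by_contra! hle
  refine hunfinished ⟨hrelease, fun u hu => ?_⟩
  rcases hu.cases_tail with rfl | ⟨w, huw, hwv⟩
  · exact hle
  · exact (hpred w hwv).2 u huw

/-- A predecessor that finishes last: the sets of times at which the predecessors are finished are
closed upwards, hence totally ordered by inclusion. -/
theorem exists_edge_forall_vertexFinished {v : V i} (hv : ∃ u, S.edge i u v) :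
    ∃ u, S.edge i u v ∧ ∀ t, W.VertexFinished σ i k u t →
      ∀ w, S.edge i w v → W.VertexFinished σ i k w t := by
  obtain ⟨u, huv, hmin⟩ := Set.Finite.exists_minimalFor
    (fun u => {t | W.VertexFinished σ i k u t}) {u | S.edge i u v} (Set.toFinite _) hv
  refine ⟨u, huv, fun t hut w hwv => ?_⟩
  by_contra hwt
  have hsub : {s | W.VertexFinished σ i k w s} ⊆ {s | W.VertexFinished σ i k u s} :=
    fun s hws => hut.mono (le_of_not_ge fun hst => hwt (VertexFinished.mono hws hst))
  exact hwt (hmin hwv hsub hut)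

theorem exists_path_eligible (hk : k ∈ W.released i) (v : V i) :
    ∃ l : List (V i), l.IsChain (S.edge i) ∧ l.head? = some (S.head i) ∧
      l.getLast? = some v ∧ ∀ t, W.release i k ≤ t → ¬ W.VertexFinished σ i k v t →
        ∃ w ∈ l, W.Eligible σ i k w t := by
  induction v using (wellFounded_of_acyclic (S.acyclic i)).induction with
  | _ v ih =>
    by_cases hpred : ∃ u, S.edge i u v
    · obtain ⟨u, huv, hlast⟩ := exists_edge_forall_vertexFinished (σ := σ) (k := k) hpred
      obtain ⟨l, hchain, hhead, hgetLast, hcover⟩ := ih u huv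
      refine ⟨l ++ [v], hchain.append (List.isChain_singleton v) (by simp [hgetLast, huv]),
        by simp [hhead], by simp, fun t ht hvt => ?_⟩
      by_cases hut : W.VertexFinished σ i k u t
      · exact ⟨v, by simp, hk, ht, hlast t hut, hvt⟩
      · obtain ⟨w, hw, helig⟩ := hcover t ht hut
        exact ⟨w, List.mem_append_left _ hw, helig⟩
    · push Not at hpred
      refine ⟨[v], List.isChain_singleton v, by simp [(S.head_iff i v).1 hpred], by simp,
        fun t ht hvt => ⟨v, by simp, hk, ht, fun u huv => (hpred u huv).elim, hvt⟩⟩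

theorem exists_isCompletePath_eligible (hk : k ∈ W.released i) :
    ∃ l : List (V i), S.IsCompletePath i l ∧ ∀ t, W.release i k ≤ t →
      ¬ W.JobFinished σ i k t → ∃ w ∈ l, W.Eligible σ i k w t := by
  obtain ⟨l, hchain, hhead, hlast, hcover⟩ := exists_path_eligible (σ := σ) hk (S.tail i)
  exact ⟨l, ⟨hchain, hhead, hlast⟩, fun t ht hunfinished =>
    hcover t ht (hunfinished ∘ jobFinished_of_vertexFinished_tail)⟩

theorem responseTime_le_of_jobFinished {b : ℝ} (h : W.JobFinished σ i k (W.release i k + b)) :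
    W.responseTime σ i k ≤ (b : EReal) := by
  refine EReal.sub_le_of_le_add' ?_
  rw [← EReal.coe_add]
  exact sInf_le ⟨_, h, rfl⟩

theorem meetsDeadline_of_wcrt_le (h : W.wcrt σ i ≤ (S.deadline i : EReal))
    (hk : k ∈ W.released i) : W.MeetsDeadline σ i k := by
  intro t ht
  have hresponse : W.responseTime σ i k ≤ (S.deadline i : EReal) :=
    (le_iSup₂ (f := fun k _ => W.responseTime σ i k) k hk).trans h
  rw [responseTime,
    EReal.sub_le_iff_le_add (Or.inl (EReal.coe_ne_bot _)) (Or.inl (EReal.coe_ne_top _)),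
    ← EReal.coe_add, add_comm] at hresponse
  obtain ⟨_, ⟨s, hs, rfl⟩, hst⟩ :=
    sInf_lt_iff.1 (hresponse.trans_lt (EReal.coe_lt_coe_iff.2 ht))
  exact hs.mono (EReal.coe_lt_coe_iff.1 hst).le

end Finishing

section ActiveJobs

theorem Eligible.sub_deadline_le_release {l : ℕ} {u : V j} {r t : ℝ}
    (h : W.Eligible σ j l u t) (hrt : r < t) (hprior : W.MeetsDeadlinesBefore σ j r) :
    r - S.deadline j ≤ W.release j l := by
  by_contra! hlt
  obtain ⟨hl, -, -, hunfinished⟩ := h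
  exact hunfinished
    (hprior l hl (by linarith [S.deadline_pos j]) t (by linarith) u)

theorem Eligible.eq_of_mem_Ioo_deadline {l : ℕ} {v : V i} {t : ℝ} (h : W.Eligible σ i l v t)
    (hk : k ∈ W.released i)
    (ht : t ∈ Set.Ioo (W.release i k) (W.release i k + S.deadline i))
    (hprior : W.MeetsDeadlinesBefore σ i (W.release i k)) : l = k := by
  obtain ⟨hl, hlt, -, hunfinished⟩ := h
  have hDT := S.deadline_le_period i
  rcases lt_trichotomy l k with hlk | hlk | hkl
  · have hsep := W.separation i l hl k hk hlk
    exact absurd (hprior l hl (W.release_strictMonoOn i hl hk hlk) t (by linarith [ht.1]) v)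
      hunfinished
  · exact hlk
  · linarith [W.separation i k hk l hl hkl, ht.2]

end ActiveJobs

namespace IsWorkConservingSchedule

variable (hσ : W.IsWorkConservingSchedule σ)
include hσ

section SupplyBounds

theorem eligible_of_executing {v : V i} {t : ℝ} (h : W.Executing σ i k v t) :
    W.Eligible σ i k v t :=
  h.elim fun p hp => hσ.eligible i p k v t (Or.inl hp)

theorem measurableSet_executing (i : ι) (k : ℕ) (v : V i) :
    MeasurableSet {t | W.Executing σ i k v t} := by
  simp only [Executing, Set.ofPred_exists]
  exact MeasurableSet.iUnion fun p => hσ.measurable i p _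

theorem measurableSet_jobExecution (i : ι) (k : ℕ) (p : Fin (S.procs i)) :
    MeasurableSet (W.jobExecution σ i k p) := by
  simp only [jobExecution, Set.ofPred_exists]
  exact MeasurableSet.iUnion fun v => hσ.measurable i p _

theorem volume_executing_inter_progress_preimage_le (i : ι) (k : ℕ) (v : V i) (a b : ℝ) :
    volume ({t | W.Executing σ i k v t} ∩ W.progress σ i k v ⁻¹' Set.Ico a b) ≤
      ENNReal.ofReal (b - a) :=
  measure_inter_elapsed_preimage_Ico_le (hσ.measurableSet_executing i k v)
    (fun _ ht => (hσ.eligible_of_executing ht).2.1) a b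

theorem volume_executing_le (i : ι) (k : ℕ) (v : V i) :
    volume {t | W.Executing σ i k v t} ≤ ENNReal.ofReal (W.execTime i k v) := by
  have hsub : {t | W.Executing σ i k v t} ⊆ {t | W.Executing σ i k v t} ∩
      W.progress σ i k v ⁻¹' Set.Ico 0 (W.execTime i k v) := fun t ht =>
    ⟨ht, elapsed_nonneg _ _ _, (hσ.eligible_of_executing ht).progress_lt⟩
  simpa only [sub_zero] using
    (measure_mono hsub).trans (hσ.volume_executing_inter_progress_preimage_le i k v 0 _)

theorem progress_le_wcet (i : ι) (k : ℕ) (v : V i) (t : ℝ) :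
    W.progress σ i k v t ≤ S.wcet i v := by
  refine le_trans ?_ (W.execTime_le i k v)
  rw [← ENNReal.ofReal_le_ofReal_iff (W.execTime_nonneg i k v)]
  exact (ofReal_elapsed _ _ _).trans_le
    ((measure_mono Set.inter_subset_left).trans (hσ.volume_executing_le i k v))

theorem volume_pathExecution_le (k : ℕ) {l : List (V i)} (hl : S.IsCompletePath i l) :
    volume (W.pathExecution σ i k l) ≤ ENNReal.ofReal (S.longestPath i) := by
  classical
  have hunion : W.pathExecution σ i k l = ⋃ v ∈ l.toFinset, {t | W.Executing σ i k v t} := by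
    ext t
    simp [pathExecution]
  have hnodup := nodup_of_isChain_of_acyclic (S.acyclic i) hl.1
  calc volume (W.pathExecution σ i k l)
      ≤ ∑ v ∈ l.toFinset, volume {t | W.Executing σ i k v t} :=
        hunion ▸ measure_biUnion_finset_le _ _
    _ ≤ ∑ v ∈ l.toFinset, ENNReal.ofReal (S.wcet i v) := by
        gcongr with v
        exact (hσ.volume_executing_le i k v).trans
          (ENNReal.ofReal_le_ofReal (W.execTime_le i k v))
    _ = ENNReal.ofReal (l.map (S.wcet i)).sum := by
        rw [← ENNReal.ofReal_sum_of_nonneg fun v _ => S.wcet_nonneg i v,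
          List.sum_toFinset _ hnodup]
    _ ≤ ENNReal.ofReal (S.longestPath i) :=
        ENNReal.ofReal_le_ofReal (S.sum_wcet_le_longestPath i hl)

theorem volume_holds_le (i : ι) (k : ℕ) (v : V i) (q : ρ) :
    volume {t | W.Holds σ i k v q t} ≤ (W.sections i k v).countP (fun s => decide (s.res = q)) *
      ENNReal.ofReal (S.accessTime i q) := by
  classical
  let accesses := (W.sections i k v).filter fun s => decide (s.res = q)
  have hmem {s : CritSection ρ} : s ∈ accesses ↔ s ∈ W.sections i k v ∧ s.res = q := by
    simp [accesses]
  have hsub : {t | W.Holds σ i k v q t} ⊆ ⋃ s ∈ accesses.toFinset, {t | W.Executing σ i k v t} ∩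
      W.progress σ i k v ⁻¹' Set.Ico s.start (s.start + s.len) := by
    rintro t ⟨hexec, s, hs, hq, hprogress⟩
    exact Set.mem_biUnion (List.mem_toFinset.2 (hmem.2 ⟨hs, hq⟩)) ⟨hexec, hprogress⟩
  calc volume {t | W.Holds σ i k v q t}
      ≤ ∑ s ∈ accesses.toFinset, volume ({t | W.Executing σ i k v t} ∩
          W.progress σ i k v ⁻¹' Set.Ico s.start (s.start + s.len)) :=
        (measure_mono hsub).trans (measure_biUnion_finset_le _ _)
    _ ≤ ∑ _s ∈ accesses.toFinset, ENNReal.ofReal (S.accessTime i q) := by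
        refine Finset.sum_le_sum fun s hs => ?_
        obtain ⟨hsection, hq⟩ := hmem.1 (List.mem_toFinset.1 hs)
        refine (hσ.volume_executing_inter_progress_preimage_le i k v _ _).trans ?_
        rw [add_sub_cancel_left, ← hq]
        exact ENNReal.ofReal_le_ofReal (W.sections_len_le i k v s hsection)
    _ = accesses.toFinset.card * ENNReal.ofReal (S.accessTime i q) := by
        rw [Finset.sum_const, nsmul_eq_mul]
    _ ≤ (W.sections i k v).countP (fun s => decide (s.res = q)) *
          ENNReal.ofReal (S.accessTime i q) := by
        rw [List.countP_eq_length_filter]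
        gcongr
        exact accesses.toFinset_card_le

theorem volume_jobHolding_le (i : ι) (k : ℕ) (q : ρ) :
    volume (W.jobHolding σ i k q) ≤ ENNReal.ofReal (S.numAccess i q * S.accessTime i q) := by
  rw [ENNReal.ofReal_mul (Nat.cast_nonneg _), ENNReal.ofReal_natCast, jobHolding,
    Set.ofPred_exists]
  calc volume (⋃ v, {t | W.Holds σ i k v q t})
      ≤ ∑ v, ((W.sections i k v).countP fun s => decide (s.res = q)) *
          ENNReal.ofReal (S.accessTime i q) :=
        (measure_iUnion_fintype_le _ _).trans
          (Finset.sum_le_sum fun v _ => hσ.volume_holds_le i k v q)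
    _ ≤ S.numAccess i q * ENNReal.ofReal (S.accessTime i q) := by
        rw [← Finset.sum_mul]
        gcongr
        exact_mod_cast W.sections_count i k q

theorem volume_ownHolding_le (i : ι) (k : ℕ) :
    volume (W.ownHolding σ i k) ≤ ENNReal.ofReal (S.ownAccessTime i) := by
  rw [TaskSystem.ownAccessTime, ENNReal.ofReal_sum_of_nonneg fun q _ =>
    S.numAccess_mul_accessTime_nonneg i q]
  exact (measure_biUnion_finset_le _ _).trans
    (Finset.sum_le_sum fun q _ => hσ.volume_jobHolding_le i k q)

theorem sum_volume_jobExecution_inter_le (i : ι) (k : ℕ) (b : ℝ) :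
    ∑ p, volume (W.jobExecution σ i k p ∩ Set.Ioo (W.release i k) b) ≤
      ENNReal.ofReal (∑ v, W.progress σ i k v b) := by
  set I := Set.Ioo (W.release i k) b
  calc ∑ p, volume (W.jobExecution σ i k p ∩ I)
      ≤ ∑ p, ∑ v, volume ({t | σ i p t = .executing k v} ∩ I) := by
        refine Finset.sum_le_sum fun p _ => ?_
        rw [jobExecution, Set.ofPred_exists, Set.iUnion_inter]
        exact measure_iUnion_fintype_le _ _
    _ = ∑ v, ∑ p, volume ({t | σ i p t = .executing k v} ∩ I) := Finset.sum_comm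
    _ = ∑ v, volume ({t | W.Executing σ i k v t} ∩ I) := by
        refine Finset.sum_congr rfl fun v _ => ?_
        simp only [Executing, Set.ofPred_exists, Set.iUnion_inter]
        rw [measure_iUnion, tsum_fintype]
        · exact fun p p' hne => Set.disjoint_left.2 fun t ht ht' =>
            hne (hσ.one_proc i p p' k v t (Or.inl ht.1) (Or.inl ht'.1))
        · exact fun p => (hσ.measurable i p _).inter measurableSet_Ioo
    _ ≤ ∑ v, ENNReal.ofReal (W.progress σ i k v b) := by
        refine Finset.sum_le_sum fun v _ => ?_
        rw [progress, ← elapsed, ofReal_elapsed]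
        exact measure_mono (Set.inter_subset_inter_right _ Set.Ioo_subset_Ico_self)
    _ = ENNReal.ofReal (∑ v, W.progress σ i k v b) :=
        (ENNReal.ofReal_sum_of_nonneg fun v _ => elapsed_nonneg _ _ _).symm

end SupplyBounds

section Window

theorem volume_iUnion_jobHolding_inter_le {q : ρ} (hqi : q ∈ S.resources i)
    {r b : ℝ} (hb : b ≤ r + S.deadline i) (hprior : W.MeetsDeadlinesBefore σ j r) :
    volume ((⋃ l, W.jobHolding σ j l q) ∩ Set.Ioo r b) ≤
      ENNReal.ofReal (S.eta i j q * S.numAccess j q * S.accessTime j q) := by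
  by_cases hqj : q ∈ S.resources j
  swap
  · have hempty : ⋃ l, W.jobHolding σ j l q = ∅ := by
      refine Set.iUnion_eq_empty.2 fun l => Set.eq_empty_of_forall_notMem ?_
      rintro t ⟨u, -, s, hs, rfl, -⟩
      exact hqj (W.sections_res j l u s hs)
    simp [hempty]
  set F := W.released j ∩
    W.release j ⁻¹' Set.Ico (r - S.deadline j) (r + S.deadline i) with hF
  have hencard : F.encard ≤ S.eta i j q := by
    have hcard := encard_inter_preimage_Ico_le (S.period_pos j)
      (W.pairwise_period_le_abs_release_sub j) (r - S.deadline j) (r + S.deadline i)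
    rwa [← hF, show r + S.deadline i - (r - S.deadline j) = S.deadline i + S.deadline j by ring,
      ← S.eta_of_mem hqi hqj] at hcard
  obtain ⟨hfin, hncard⟩ := Set.encard_le_coe_iff_finite_ncard_le.1 hencard
  have hsub : (⋃ l, W.jobHolding σ j l q) ∩ Set.Ioo r b ⊆
      ⋃ l ∈ hfin.toFinset, W.jobHolding σ j l q := by
    rintro t ⟨hholding, hrt, htb⟩
    obtain ⟨l, u, hu⟩ := Set.mem_iUnion.1 hholding
    have helig := hσ.eligible_of_executing hu.1
    refine Set.mem_biUnion (hfin.mem_toFinset.2 ⟨helig.1, ?_, ?_⟩) ⟨u, hu⟩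
    · exact helig.sub_deadline_le_release hrt hprior
    · linarith [helig.2.1]
  calc volume ((⋃ l, W.jobHolding σ j l q) ∩ Set.Ioo r b)
      ≤ ∑ l ∈ hfin.toFinset, volume (W.jobHolding σ j l q) :=
        (measure_mono hsub).trans (measure_biUnion_finset_le _ _)
    _ ≤ hfin.toFinset.card * ENNReal.ofReal (S.numAccess j q * S.accessTime j q) := by
        rw [← nsmul_eq_mul]
        exact Finset.sum_le_card_nsmul _ _ _ fun l _ => hσ.volume_jobHolding_le j l q
    _ ≤ S.eta i j q * ENNReal.ofReal (S.numAccess j q * S.accessTime j q) := by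
        rw [← Set.ncard_eq_toFinset_card F hfin]
        gcongr
    _ = ENNReal.ofReal (S.eta i j q * S.numAccess j q * S.accessTime j q) := by
        rw [mul_assoc, ENNReal.ofReal_mul (p := (S.eta i j q : ℝ)) (Nat.cast_nonneg _),
          ENNReal.ofReal_natCast]

theorem volume_foreignHolding_inter_le [Fintype ι] [DecidableEq ι] {r b : ℝ}
    (hb : b ≤ r + S.deadline i) (hprior : ∀ j, W.MeetsDeadlinesBefore σ j r) :
    volume (W.foreignHolding σ i ∩ Set.Ioo r b) ≤ ENNReal.ofReal (S.interTaskBlocking i) := by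
  have hsub : W.foreignHolding σ i ∩ Set.Ioo r b ⊆ ⋃ j ∈ Finset.univ.erase i,
      ⋃ q ∈ S.resources i, (⋃ l, W.jobHolding σ j l q) ∩ Set.Ioo r b := by
    rintro t ⟨⟨j, hj, q, hq, l, hl⟩, ht⟩
    exact Set.mem_biUnion (by simpa using hj)
      (Set.mem_biUnion hq ⟨Set.mem_iUnion.2 ⟨l, hl⟩, ht⟩)
  have hnonneg := S.eta_mul_numAccess_mul_accessTime_nonneg i
  rw [TaskSystem.interTaskBlocking, ENNReal.ofReal_sum_of_nonneg fun j _ =>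
    Finset.sum_nonneg fun q _ => hnonneg j q]
  refine (measure_mono hsub).trans ((measure_biUnion_finset_le _ _).trans
    (Finset.sum_le_sum fun j _ => ?_))
  rw [ENNReal.ofReal_sum_of_nonneg fun q _ => hnonneg j q]
  exact (measure_biUnion_finset_le _ _).trans (Finset.sum_le_sum fun q hq =>
    hσ.volume_iUnion_jobHolding_inter_le hq hb (hprior j))

theorem mem_ownHolding_or_mem_foreignHolding_of_spinning {t : ℝ} {p : Fin (S.procs i)} {l : ℕ}
    {v : V i} (honly : ∀ l v, W.Eligible σ i l v t → l = k) (h : σ i p t = .spinning l v) :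
    t ∈ W.ownHolding σ i k ∨ t ∈ W.foreignHolding σ i := by
  obtain ⟨s, hs, -, j, l', u, hholds⟩ := hσ.spinning i p l v t h
  have hres := W.sections_res i l v s hs
  by_cases hj : j = i
  · subst hj
    obtain rfl := honly l' u (hσ.eligible_of_executing hholds.1)
    exact Or.inl (Set.mem_biUnion hres ⟨u, hholds⟩)
  · exact Or.inr ⟨j, hj, s.res, hres, l', u, hholds⟩

theorem mem_jobExecution_of_eligible {t : ℝ} {l : List (V i)} {w : V i} (hw : w ∈ l)
    (helig : W.Eligible σ i k w t) (honly : ∀ l v, W.Eligible σ i l v t → l = k)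
    (hpath : t ∉ W.pathExecution σ i k l) (hown : t ∉ W.ownHolding σ i k)
    (hforeign : t ∉ W.foreignHolding σ i) (p : Fin (S.procs i)) :
    t ∈ W.jobExecution σ i k p := by
  have hspin (p l v) : σ i p t ≠ .spinning l v := fun h =>
    (hσ.mem_ownHolding_or_mem_foreignHolding_of_spinning honly h).elim hown hforeign
  rcases hσ.work_conserving i k w t helig with ⟨p', hexec | hspinning⟩ | hbusy
  · exact (hpath ⟨w, hw, p', hexec⟩).elim
  · exact (hspin p' k w hspinning).elim
  · rcases hp : σ i p t with _ | ⟨l', v⟩ | ⟨l', v⟩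
    · exact (hbusy p hp).elim
    · obtain rfl := honly l' v (hσ.eligible i p l' v t (Or.inl hp))
      exact ⟨v, hp⟩
    · exact (hspin p l' v hp).elim

theorem procs_mul_volume_Ioo_sdiff_foreignHolding_le (hk : k ∈ W.released i) {b : ℝ}
    (hb : b ≤ W.release i k + S.deadline i) (hunfinished : ¬ W.JobFinished σ i k b)
    (hprior : W.MeetsDeadlinesBefore σ i (W.release i k)) :
    S.procs i * volume (Set.Ioo (W.release i k) b \ W.foreignHolding σ i) ≤
      ENNReal.ofReal (∑ v, W.progress σ i k v b) +
        (S.procs i - 1 : ℕ) * ENNReal.ofReal (S.longestPath i + S.ownAccessTime i) := by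
  set I := Set.Ioo (W.release i k) b
  obtain ⟨l, hl, hcover⟩ := exists_isCompletePath_eligible (σ := σ) hk
  set G := W.pathExecution σ i k l ∪ W.ownHolding σ i k
  have hsome : (I \ W.foreignHolding σ i) ∩ G ⊆ ⋃ p, W.jobExecution σ i k p ∩ I := by
    rintro t ⟨⟨ht, -⟩, ⟨v, -, p, hp⟩ | hown⟩
    · exact Set.mem_iUnion.2 ⟨p, ⟨v, hp⟩, ht⟩
    · obtain ⟨q, -, v, ⟨p, hp⟩, -⟩ := Set.mem_iUnion₂.1 hown
      exact Set.mem_iUnion.2 ⟨p, ⟨v, hp⟩, ht⟩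
  have hall (p : Fin (S.procs i)) :
      (I \ W.foreignHolding σ i) \ G ⊆ W.jobExecution σ i k p ∩ I := by
    rintro t ⟨⟨ht, hforeign⟩, hG⟩
    obtain ⟨hpath, hown⟩ := not_or.1 hG
    obtain ⟨w, hw, helig⟩ := hcover t ht.1.le fun h => hunfinished (h.mono ht.2.le)
    have honly (l v) (h : W.Eligible σ i l v t) : l = k :=
      h.eq_of_mem_Ioo_deadline hk ⟨ht.1, ht.2.trans_le hb⟩ hprior
    exact ⟨hσ.mem_jobExecution_of_eligible hw helig honly hpath hown hforeign p, ht⟩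
  have hG : volume G ≤ ENNReal.ofReal (S.longestPath i + S.ownAccessTime i) := by
    rw [ENNReal.ofReal_add (S.longestPath_nonneg i) (S.ownAccessTime_nonneg i)]
    exact (measure_union_le _ _).trans
      (add_le_add (hσ.volume_pathExecution_le k hl) (hσ.volume_ownHolding_le i k))
  have hcount := card_mul_measure_le_sum_add volume
    (fun p => (hσ.measurableSet_jobExecution i k p).inter measurableSet_Ioo) hsome hall
  rw [Fintype.card_fin] at hcount
  refine hcount.trans ?_
  gcongr
  exact hσ.sum_volume_jobExecution_inter_le i k b

theorem procs_mul_sub_release_le [Fintype ι] [DecidableEq ι] (hk : k ∈ W.released i) {b : ℝ}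
    (hb : b ≤ W.release i k + S.deadline i) (hunfinished : ¬ W.JobFinished σ i k b)
    (hprior : ∀ j, W.MeetsDeadlinesBefore σ j (W.release i k)) :
    S.procs i * (b - W.release i k) ≤ ∑ v, W.progress σ i k v b +
      (S.procs i - 1) * (S.longestPath i + S.ownAccessTime i) +
        S.procs i * S.interTaskBlocking i := by
  set r := W.release i k
  have hprogress : 0 ≤ ∑ v, W.progress σ i k v b :=
    Finset.sum_nonneg fun v _ => elapsed_nonneg _ _ _
  have hprocs := sub_nonneg.2 (S.one_le_cast_procs i)
  have hpath := S.longestPath_nonneg i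
  have haccess := S.ownAccessTime_nonneg i
  have hblocking := S.interTaskBlocking_nonneg i
  have hsplit : ENNReal.ofReal (b - r) ≤
      ENNReal.ofReal (S.interTaskBlocking i) + volume (Set.Ioo r b \ W.foreignHolding σ i) := by
    rw [← Real.volume_Ioo]
    refine (measure_le_inter_add_sdiff _ _ (W.foreignHolding σ i)).trans ?_
    grw [Set.inter_comm, hσ.volume_foreignHolding_inter_le hb hprior]
  rw [← ENNReal.ofReal_le_ofReal_iff (by positivity), ENNReal.ofReal_mul (Nat.cast_nonneg _),
    ENNReal.ofReal_natCast]
  grw [hsplit, mul_add,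
    hσ.procs_mul_volume_Ioo_sdiff_foreignHolding_le hk hb hunfinished (hprior i)]
  rw [← ENNReal.ofReal_natCast, ← ENNReal.ofReal_natCast, ← ENNReal.ofReal_mul (by positivity),
    ← ENNReal.ofReal_mul (by positivity), ← ENNReal.ofReal_add (by positivity) (by positivity),
    ← ENNReal.ofReal_add (by positivity) (by positivity), Nat.cast_pred (S.procs_pos i), add_comm]

end Window

theorem jobFinished_of_meetsDeadlinesBefore [Fintype ι] [DecidableEq ι] (hk : k ∈ W.released i)
    (hbound : S.unorderedBound i ≤ S.deadline i)
    (hprior : ∀ j, W.MeetsDeadlinesBefore σ j (W.release i k)) :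
    W.JobFinished σ i k (W.release i k + S.unorderedBound i) := by
  by_contra hunfinished
  set b := W.release i k + S.unorderedBound i
  obtain ⟨v, hv⟩ := exists_progress_lt_of_not_jobFinished
    (le_add_of_nonneg_right (S.unorderedBound_nonneg i)) hunfinished
  have hwork : ∑ v, W.progress σ i k v b < S.totalWork i :=
    Finset.sum_lt_sum (fun v _ => hσ.progress_le_wcet i k v b)
      ⟨v, Finset.mem_univ v, hv.trans_le (W.execTime_le i k v)⟩
  have hwindow := hσ.procs_mul_sub_release_le hk (add_le_add_right hbound _) hunfinished hprior
  rw [add_sub_cancel_left, S.procs_mul_unorderedBound i] at hwindow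
  linarith

theorem meetsDeadline [Fintype ι] [DecidableEq ι]
    (hdeadline : ∀ j, W.wcrt σ j ≤ (S.deadline j : EReal) ∨ S.unorderedBound j ≤ S.deadline j)
    (hk : k ∈ W.released i) : W.MeetsDeadline σ i k := by
  refine W.isWF_iUnion_release_image_released.induction
    (P := fun r => ∀ j, ∀ l ∈ W.released j, W.release j l = r → W.MeetsDeadline σ j l)
    (Set.mem_iUnion.2 ⟨i, Set.mem_image_of_mem _ hk⟩) ?_ i k hk rfl
  rintro _ - ih j l hl rfl
  rcases hdeadline j with hwcrt | hbound
  · exact meetsDeadline_of_wcrt_le hwcrt hl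
  · have hprior (j') : W.MeetsDeadlinesBefore σ j' (W.release j l) := fun l' hl' hlt =>
      ih _ (Set.mem_iUnion.2 ⟨j', Set.mem_image_of_mem _ hl'⟩) hlt j' l' hl' rfl
    exact fun t ht => (hσ.jobFinished_of_meetsDeadlinesBefore hl hbound hprior).mono (by linarith)

end IsWorkConservingSchedule

end Workload

end SpinLock


theorem mainTheorem2_general {ι ρ : Type*} [Fintype ι] [DecidableEq ι] [DecidableEq ρ]
    {V : ι → Type*} [∀ i, Fintype (V i)]
    (S : SpinLock.TaskSystem ι ρ V) (W : SpinLock.Workload S) (σ : W.Trace)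
    (hσ : W.IsWorkConservingSchedule σ)
    (hdeadline : ∀ k, W.wcrt σ k ≤ ((S.deadline k : ℝ) : EReal) ∨
      S.unorderedBound k ≤ S.deadline k)
    (i : ι) :
    W.wcrt σ i ≤ ((S.unorderedBound i : ℝ) : EReal) := by
  rcases le_or_gt (S.unorderedBound i) (S.deadline i) with hle | hlt
  · exact iSup₂_le fun k hk => SpinLock.Workload.responseTime_le_of_jobFinished
      (hσ.jobFinished_of_meetsDeadlinesBefore hk hle fun j l hl _ => hσ.meetsDeadline hdeadline hl)
  · exact ((hdeadline i).resolve_right hlt.not_ge).trans (EReal.coe_le_coe_iff.2 hlt.le)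

theorem mainTheorem2 {ι ρ : Type*} [Fintype ι] [DecidableEq ι] [Fintype ρ] [DecidableEq ρ]
    {V : ι → Type*} [∀ i, Fintype (V i)]
    (S : SpinLock.TaskSystem ι ρ V) (W : SpinLock.Workload S) (σ : W.Trace)
    (hσ : W.IsSchedule σ)
    (hdeadline : ∀ k, W.wcrt σ k ≤ ((S.deadline k : ℝ) : EReal) ∨
      S.unorderedBound k ≤ S.deadline k)
    (i : ι) :
    W.wcrt σ i ≤ ((S.unorderedBound i : ℝ) : EReal) :=
  mainTheorem2_general S W σ hσ.isWorkConservingSchedule hdeadline i
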